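/- A rooted plane tree consists of a root and a (possibly empty) linearly ordered finite list of rooted plane trees, the subtrees of the root; its size is its number of vertices, and a leaf is a vertex without children. The rank of a vertex is the length (number of edges) of a shortest downward path from it to a leaf. For $n\ge 1$ let $E_R(n)$ be the expected value of the rank of the root of a rooted plane tree chosen uniformly at random among all (unlabeled) rooted plane trees of size $n$. Then the series $\sum_{k=1}^{\infty}\frac{9}{4^{1-k}+4+4^{k}}$ converges and $$\lim_{n\to\infty}E_R(n)=\sum_{k=1}^{\infty}\frac{9}{4^{1-k}+4+4^{k}}\approx 1.62297,$$ where the numerical value is correct to the five decimals shown, i.e. the error is less than $5\cdot 10^{-6}$. -/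

import Mathlib

/-- Unlabeled rooted plane trees: a root together with the (possibly empty) linearly ordered list of
the subtrees hanging from it. Two such trees are the same exactly when they are equal. -/
inductive PlaneTree : Type where
  | node (children : List PlaneTree) : PlaneTree

namespace PlaneTree

/-- The size of a tree: its number of vertices. -/
def size : PlaneTree → ℕ
  | node cs => 1 + (cs.map size).sum

/-- `LeafPath t d`: there is a downward path with exactly `d` steps from the root of `t` to a leaf,
a leaf being a vertex without children. -/
inductive LeafPath : PlaneTree → ℕ → Prop where
  | leaf : LeafPath (node []) 0
  | step (cs : List PlaneTree) (c : PlaneTree) (d : ℕ) (hc : c ∈ cs) (h : LeafPath c d) :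
      LeafPath (node cs) (d + 1)

/-- Every tree has a downward path from its root to a leaf. -/
theorem exists_leafPath : ∀ t : PlaneTree, ∃ d, LeafPath t d
  | node [] => ⟨0, .leaf⟩
  | node (c :: cs) =>
    let ⟨d, hd⟩ := exists_leafPath c
    ⟨d + 1, .step (c :: cs) c d List.mem_cons_self hd⟩

/-- The rank of the root of `t`: the length of a shortest downward path from the root to a leaf
(the set is nonempty by `exists_leafPath`). -/
noncomputable def rootRank (t : PlaneTree) : ℕ :=
  sInf {d | LeafPath t d}

/-- There are only finitely many trees of a given size. -/
theorem finite_size_eq (n : ℕ) : {t : PlaneTree | t.size = n}.Finite := by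
  induction n using Nat.strong_induction_on with
  | _ n ih =>
    have hS : {t : PlaneTree | t.size < n}.Finite := by
      have h : {t : PlaneTree | t.size < n} = ⋃ m ∈ Set.Iio n, {t : PlaneTree | t.size = m} := by
        ext t; simp
      rw [h]
      exact (Set.finite_Iio n).biUnion fun m hm => ih m hm
    have : Finite {t : PlaneTree | t.size < n} := hS
    refine (((List.finite_length_le {t : PlaneTree | t.size < n} n).image
      (List.map Subtype.val)).image node).subset ?_
    rintro ⟨cs⟩ ht
    have ht' : 1 + (cs.map size).sum = n := by simpa [size] using ht
    have hlt : ∀ c ∈ cs, c.size < n := fun c hc => by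
      have := List.single_le_sum (l := cs.map size) (by simp) _ (List.mem_map_of_mem hc)
      omega
    have hlen : cs.length ≤ n := by
      have h1 : ∀ c ∈ cs.map size, 1 ≤ c := by
        intro m hm
        obtain ⟨⟨ds⟩, -, rfl⟩ := List.mem_map.1 hm
        simp [size]
      have := List.length_le_sum_of_one_le _ h1
      simp only [List.length_map] at this
      omega
    refine ⟨cs, ⟨cs.attachWith (fun c => c ∈ {t : PlaneTree | t.size < n}) hlt, ?_, ?_⟩, rfl⟩
    · rw [Set.mem_ofPred_eq, List.length_attachWith]
      exact hlen
    · simp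

/-- The finite set of all trees with `n` vertices. -/
noncomputable def ofSize (n : ℕ) : Finset PlaneTree :=
  (finite_size_eq n).toFinset

/-- The expected rank of the root of a uniformly random tree with `n` vertices
(trees with `n` vertices exist exactly for `n ≥ 1`). -/
noncomputable def expectedRootRank (n : ℕ) : ℝ :=
  (∑ t ∈ ofSize n, (rootRank t : ℝ)) / ((ofSize n).card : ℝ)

end PlaneTree

/-! Let `T_k` count, by size, the trees whose root has rank at least `k`, and write `T = T_0`. The
expected rank is the sum over `k ≥ 1` of the probabilities of rank at least `k`; it suffices to find
the limit of each and to dominate them by a summable sequence.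

Splitting off the first subtree gives `T_{k+1} = T_k (X + T_{k+1})` and `T² = T - X` (`rankGF_succ`,
`rankGF_zero_sq`). The first relation iterates a Möbius map, hence has an explicit solution
(`rankGF_mul_denom`); multiplying by the conjugate of its denominator, under `T ↦ 1 - T`, leaves a
polynomial denominator (`rankGF_rational`). So the counts satisfy a linear recurrence with constant
coefficients, driven by the Catalan numbers, whose consecutive ratios tend to `1/4`. At `1/4` the
lower-order coefficients have total weight below one, so the recurrence contracts and the
probabilities converge (`tendsto_ratio_of_recurrence`), without singularity analysis. The bound
`(4/5)^k` (`rankCount_ratio_le`) allows dominated convergence. -/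

namespace PlaneTree

/-! ### Decomposition of trees by first subtree -/

/-- The list of the subtrees hanging from the root. -/
def children : PlaneTree → List PlaneTree
  | node cs => cs

theorem size_node (cs : List PlaneTree) : (node cs).size = 1 + (cs.map size).sum := by
  simp [size]

theorem size_pos (t : PlaneTree) : 0 < t.size := by
  obtain ⟨cs⟩ := t
  rw [size_node]
  omega

theorem mem_ofSize {n : ℕ} {t : PlaneTree} : t ∈ ofSize n ↔ t.size = n := by
  simp [ofSize]

theorem le_rootRank_iff {k : ℕ} {t : PlaneTree} :
    k ≤ rootRank t ↔ ∀ d, LeafPath t d → k ≤ d := by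
  constructor
  · intro h d hd
    exact h.trans (Nat.sInf_le hd)
  · intro h
    exact h _ (Nat.sInf_mem (exists_leafPath t))

theorem succ_le_rootRank_iff {k : ℕ} {t : PlaneTree} :
    k + 1 ≤ rootRank t ↔ t.children ≠ [] ∧ ∀ c ∈ t.children, k ≤ rootRank c := by
  obtain ⟨cs⟩ := t
  simp only [children, le_rootRank_iff]
  constructor
  · intro h
    refine ⟨?_, fun c hc d hd => ?_⟩
    · rintro rfl
      have := h 0 .leaf
      omega
    · have := h _ (.step cs c d hc hd)
      omega
  · rintro ⟨h0, h⟩ d hd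
    cases hd with
    | leaf => exact absurd rfl h0
    | step _ c d hc hd =>
      have := h c hc d hd
      omega

/-- The trees with `n` vertices whose root has rank at least `k`. -/
noncomputable def ofSizeRankGE (k n : ℕ) : Finset PlaneTree :=
  (ofSize n).filter fun t => k ≤ rootRank t

open Classical in
/-- The trees with `n` vertices in which every child of the root has rank at least `k`. -/
noncomputable def ofSizeChildrenGE (k n : ℕ) : Finset PlaneTree :=
  (ofSize n).filter fun t => ∀ c ∈ t.children, k ≤ rootRank c

theorem mem_ofSizeRankGE {k n : ℕ} {t : PlaneTree} :
    t ∈ ofSizeRankGE k n ↔ t.size = n ∧ k ≤ rootRank t := by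
  simp [ofSizeRankGE, mem_ofSize]

theorem mem_ofSizeChildrenGE {k n : ℕ} {t : PlaneTree} :
    t ∈ ofSizeChildrenGE k n ↔ t.size = n ∧ ∀ c ∈ t.children, k ≤ rootRank c := by
  simp [ofSizeChildrenGE, mem_ofSize]

/-- Attach the first tree to the root of the second as its new first subtree. -/
def graft (p : PlaneTree × PlaneTree) : PlaneTree :=
  node (p.1 :: p.2.children)

theorem graft_injective : Function.Injective graft := by
  rintro ⟨a, ⟨as⟩⟩ ⟨b, ⟨bs⟩⟩ h
  simpa [graft, children] using h

theorem size_graft (p : PlaneTree × PlaneTree) : (graft p).size = p.1.size + p.2.size := by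
  obtain ⟨a, ⟨as⟩⟩ := p
  simp only [graft, children, size_node, List.map_cons, List.sum_cons]
  omega

theorem size_eq_one_iff {t : PlaneTree} : t.size = 1 ↔ t = node [] := by
  constructor
  · obtain ⟨_ | ⟨c, cs⟩⟩ := t
    · simp
    · intro h
      rw [size_node] at h
      have := size_pos c
      simp only [List.map_cons, List.sum_cons] at h
      omega
  · rintro rfl
    simp [size_node]

theorem graft_ne_leaf (p : PlaneTree × PlaneTree) : graft p ≠ node [] := by
  simp [graft]

/-- A tree is a single vertex or, uniquely, the graft of its first subtree onto the rest; the
condition on the children splits accordingly. -/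
theorem card_ofSizeChildrenGE (k n : ℕ) :
    (ofSizeChildrenGE k n).card = (if n = 1 then 1 else 0) +
      ∑ p ∈ Finset.HasAntidiagonal.antidiagonal n,
        (ofSizeRankGE k p.1).card * (ofSizeChildrenGE k p.2).card := by
  classical
  have h : ofSizeChildrenGE k n = (if n = 1 then {node []} else ∅) ∪
      ((Finset.HasAntidiagonal.antidiagonal n).biUnion fun p =>
        ofSizeRankGE k p.1 ×ˢ ofSizeChildrenGE k p.2).image graft := by
    ext t
    simp only [mem_ofSizeChildrenGE, Finset.mem_union, Finset.mem_image, Finset.mem_biUnion,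
      Finset.HasAntidiagonal.mem_antidiagonal, Finset.mem_product, mem_ofSizeRankGE]
    constructor
    · rintro ⟨hn, ht⟩
      obtain ⟨_ | ⟨c, cs⟩⟩ := t
      · left
        rw [size_eq_one_iff.2 rfl] at hn
        simp [← hn]
      · right
        refine ⟨(c, node cs), ⟨(c.size, (node cs).size), ?_, ⟨rfl, ?_⟩, rfl, ?_⟩, rfl⟩
        · rw [← hn]
          exact (size_graft (c, node cs)).symm
        · exact ht c (by simp [children])
        · intro d hd
          exact ht d (by simp only [children] at hd ⊢; simp [hd])
    · rintro (ht | ⟨⟨a, b⟩, ⟨⟨i, j⟩, hij, ⟨ha, ha'⟩, hb, hb'⟩, rfl⟩)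
      · split_ifs at ht with hn
        · rw [Finset.mem_singleton] at ht
          subst ht
          exact ⟨by rw [hn]; exact size_eq_one_iff.2 rfl, by simp [children]⟩
        · simp at ht
      · refine ⟨?_, ?_⟩
        · rw [size_graft]
          simp only at *
          omega
        · intro c hc
          simp only [graft, children, List.mem_cons] at hc
          rcases hc with rfl | hc
          · exact ha'
          · exact hb' c hc
  rw [h, Finset.card_union_of_disjoint, Finset.card_image_of_injective _ graft_injective,
    Finset.card_biUnion]
  · congr 1
    · split_ifs <;> simp
    · simp
  · rintro ⟨i, j⟩ - ⟨i', j'⟩ - hne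
    rw [Function.onFun, Finset.disjoint_left]
    rintro ⟨a, b⟩ h1 h2
    simp only [Finset.mem_product, mem_ofSizeRankGE, mem_ofSizeChildrenGE] at h1 h2
    exact hne (Prod.ext (h1.1.1.symm.trans h2.1.1) (h1.2.1.symm.trans h2.2.1))
  · rw [Finset.disjoint_left]
    intro t h1 h2
    split_ifs at h1
    · rw [Finset.mem_singleton] at h1
      subst h1
      obtain ⟨p, -, hp⟩ := Finset.mem_image.1 h2
      exact graft_ne_leaf p hp
    · simp at h1

theorem card_ofSizeRankGE_succ (k n : ℕ) :
    (ofSizeChildrenGE k n).card = (if n = 1 then 1 else 0) + (ofSizeRankGE (k + 1) n).card := by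
  classical
  have h : ofSizeChildrenGE k n = (if n = 1 then {node []} else ∅) ∪ ofSizeRankGE (k + 1) n := by
    ext t
    simp only [mem_ofSizeChildrenGE, Finset.mem_union, mem_ofSizeRankGE, succ_le_rootRank_iff]
    by_cases ht : t = node []
    · subst ht
      rw [size_eq_one_iff.2 rfl]
      by_cases hn : n = 1 <;> simp [hn, children, eq_comm]
    · have : t.children ≠ [] := by
        obtain ⟨cs⟩ := t
        simpa [children] using ht
      split_ifs <;> simp [ht, this]
  rw [h, Finset.card_union_of_disjoint]
  · split_ifs <;> simp
  · rw [Finset.disjoint_left]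
    intro t h1 h2
    split_ifs at h1
    · rw [Finset.mem_singleton] at h1
      subst h1
      rw [mem_ofSizeRankGE, succ_le_rootRank_iff] at h2
      exact h2.2.1 rfl
    · simp at h1

theorem ofSizeRankGE_zero (n : ℕ) : ofSizeRankGE 0 n = ofSize n := by
  simp [ofSizeRankGE]

theorem ofSizeChildrenGE_zero (n : ℕ) : ofSizeChildrenGE 0 n = ofSize n := by
  simp [ofSizeChildrenGE]

theorem lt_size_of_le_rootRank {k : ℕ} {t : PlaneTree} (h : k ≤ rootRank t) : k < t.size := by
  induction k generalizing t with
  | zero => exact size_pos t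
  | succ k ih =>
    obtain ⟨hne, hc⟩ := succ_le_rootRank_iff.1 h
    obtain ⟨_ | ⟨c, cs⟩⟩ := t
    · exact absurd rfl hne
    · have := ih (hc c (by simp [children]))
      rw [size_node, List.map_cons, List.sum_cons]
      omega

theorem ofSizeRankGE_eq_empty {k n : ℕ} (h : n ≤ k) : ofSizeRankGE k n = ∅ := by
  rw [Finset.eq_empty_iff_forall_notMem]
  intro t ht
  rw [mem_ofSizeRankGE] at ht
  have := lt_size_of_le_rootRank ht.2
  omega

/-! ### Generating functions and Catalan numbers -/

/-- The generating function of the trees whose root has rank at least `k`. -/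
noncomputable def rankGF (k : ℕ) : PowerSeries ℝ :=
  PowerSeries.mk fun n => ((ofSizeRankGE k n).card : ℝ)

theorem coeff_rankGF (k n : ℕ) :
    PowerSeries.coeff n (rankGF k) = ((ofSizeRankGE k n).card : ℝ) :=
  PowerSeries.coeff_mk _ _

open PowerSeries in
theorem mk_card_ofSizeChildrenGE (k : ℕ) :
    (PowerSeries.mk fun n => ((ofSizeChildrenGE k n).card : ℝ)) = X + rankGF (k + 1) := by
  ext n
  rw [coeff_mk, card_ofSizeRankGE_succ, map_add, coeff_X, coeff_rankGF]
  push_cast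
  rfl

open PowerSeries in
theorem rankGF_succ (k : ℕ) : rankGF (k + 1) = rankGF k * (X + rankGF (k + 1)) := by
  have h : (X + rankGF (k + 1) : PowerSeries ℝ) = X + rankGF k * (X + rankGF (k + 1)) := by
    conv_lhs => rw [← mk_card_ofSizeChildrenGE]
    rw [← mk_card_ofSizeChildrenGE]
    ext n
    rw [coeff_mk, card_ofSizeChildrenGE, map_add, coeff_X, coeff_mul]
    simp only [coeff_rankGF, coeff_mk]
    push_cast
    rfl
  exact add_left_cancel h

open PowerSeries in
theorem rankGF_zero : rankGF 0 = X + rankGF 1 := by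
  rw [← mk_card_ofSizeChildrenGE]
  ext n
  rw [coeff_rankGF, coeff_mk, ofSizeRankGE_zero, ofSizeChildrenGE_zero]

open PowerSeries in
theorem rankGF_zero_sq : rankGF 0 * rankGF 0 = rankGF 0 - X := by
  have h := rankGF_succ 0
  rw [zero_add, ← rankGF_zero] at h
  rw [← h, rankGF_zero]
  ring

-- Both series solve the same quadratic, whose roots are `X * C` and `1 - X * C`; the constant
-- coefficient excludes the second.
open PowerSeries in
theorem rankGF_zero_eq_catalan :
    rankGF 0 = X * (catalanSeries.map (Nat.castRingHom ℝ)) := by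
  set C : PowerSeries ℝ := catalanSeries.map (Nat.castRingHom ℝ) with hC
  have h1 : C ^ 2 * X + 1 = C := by
    have := congrArg (PowerSeries.map (Nat.castRingHom ℝ)) catalanSeries_sq_mul_X_add_one
    simpa using this
  have h2 : (rankGF 0 - X * C) * (1 - rankGF 0 - X * C) = 0 := by
    linear_combination (-1 : PowerSeries ℝ) * rankGF_zero_sq + X * h1
  rcases mul_eq_zero.1 h2 with h | h
  · exact sub_eq_zero.1 h
  · exfalso
    have h0 : constantCoeff (rankGF 0) = 0 := by
      rw [← coeff_zero_eq_constantCoeff_apply, coeff_rankGF, ofSizeRankGE_eq_empty le_rfl,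
        Finset.card_empty, Nat.cast_zero]
    have := congrArg constantCoeff h
    simp [h0] at this

theorem card_ofSize_succ (n : ℕ) : (ofSize (n + 1)).card = catalan n := by
  have h := congrArg (PowerSeries.coeff (n + 1)) rankGF_zero_eq_catalan
  rw [coeff_rankGF, PowerSeries.coeff_succ_X_mul, PowerSeries.coeff_map,
    PowerSeries.catalanSeries_coeff, ofSizeRankGE_zero, eq_natCast] at h
  exact_mod_cast h

theorem add_two_mul_catalan_succ (n : ℕ) :
    (n + 2) * catalan (n + 1) = 2 * (2 * n + 1) * catalan n := by
  have h1 := succ_mul_catalan_eq_centralBinom (n + 1)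
  have h2 := succ_mul_catalan_eq_centralBinom n
  have h3 := Nat.succ_mul_centralBinom_succ n
  rw [← h1, ← h2] at h3
  have : 0 < n + 1 := n.succ_pos
  apply Nat.eq_of_mul_eq_mul_left this
  linarith

theorem card_ofSize_pos (n : ℕ) : 0 < (ofSize (n + 1)).card := by
  rw [card_ofSize_succ]
  have := succ_mul_catalan_eq_centralBinom n
  have h := Nat.centralBinom_pos n
  rw [← this] at h
  exact pos_of_mul_pos_right h (Nat.zero_le _)

theorem card_ofSize_ratio (n : ℕ) :
    ((ofSize (n + 1)).card : ℝ) / (ofSize (n + 2)).card = (n + 2) / (4 * n + 2) := by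
  have h := add_two_mul_catalan_succ n
  have hp : (0 : ℝ) < (ofSize (n + 2)).card := by exact_mod_cast card_ofSize_pos (n + 1)
  rw [← card_ofSize_succ, ← card_ofSize_succ] at h
  have h' : ((n : ℝ) + 2) * (ofSize (n + 2)).card = 2 * (2 * n + 1) * (ofSize (n + 1)).card := by
    exact_mod_cast h
  rw [div_eq_div_iff hp.ne' (by positivity)]
  linarith

end PlaneTree

/-! ### Ratio limits from contracting recurrences -/

/-- A bounded sequence dominated, up to a null sequence, by a combination of its own values with
asymptotic total weight less than one tends to zero. -/
theorem tendsto_zero_of_contraction {ι : Type*} (s : Finset ι) (y r : ℕ → ℝ) (w : ι → ℕ → ℝ)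
    (c : ι → ℝ) (d : ι → ℕ) (m : ℕ) (M : ℝ) (hy : ∀ n, 0 ≤ y n)
    (hM : ∀ᶠ n in Filter.atTop, y n ≤ M) (hw : ∀ i ∈ s, ∀ n, 0 ≤ w i n)
    (hwc : ∀ i ∈ s, Filter.Tendsto (w i) Filter.atTop (nhds (c i)))
    (hr : Filter.Tendsto r Filter.atTop (nhds 0)) (hc : ∑ i ∈ s, c i < 1)
    (h : ∀ᶠ n in Filter.atTop, y (n + m) ≤ ∑ i ∈ s, w i n * y (n + d i) + r n) :
    Filter.Tendsto y Filter.atTop (nhds 0) := by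
  have hc0 : 0 ≤ ∑ i ∈ s, c i := Finset.sum_nonneg fun i hi =>
    ge_of_tendsto' (hwc i hi) (hw i hi)
  obtain ⟨C, hcC, hC⟩ := exists_between hc
  -- Each pass through the inequality improves an eventual bound by the factor `C < 1`. Iteration
  -- starts from `|M| + 1`, which is positive.
  have step : ∀ B : ℝ, 0 < B → (∀ᶠ n in Filter.atTop, y n ≤ B) →
      ∀ᶠ n in Filter.atTop, y n ≤ C * B := by
    intro B hB hyB
    have hlim : Filter.Tendsto (fun n => ∑ i ∈ s, w i n * B + r n) Filter.atTop
        (nhds (∑ i ∈ s, c i * B + 0)) :=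
      (tendsto_finsetSum s fun i hi => (hwc i hi).mul_const B).add hr
    have hlt : ∑ i ∈ s, c i * B + 0 < C * B := by
      rw [add_zero, ← Finset.sum_mul]
      exact mul_lt_mul_of_pos_right hcC hB
    have hshift : ∀ᶠ n in Filter.atTop, ∀ i ∈ s, y (n + d i) ≤ B :=
      (Filter.eventually_all_finset s).2 fun i _ =>
        (Filter.tendsto_add_atTop_nat (d i)).eventually hyB
    have key : ∀ᶠ n in Filter.atTop, y (n + m) ≤ C * B := by
      filter_upwards [h, hlim.eventually_lt_const hlt, hshift] with n h1 h2 h3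
      have h4 : ∑ i ∈ s, w i n * y (n + d i) ≤ ∑ i ∈ s, w i n * B :=
        Finset.sum_le_sum fun i hi => mul_le_mul_of_nonneg_left (h3 i hi) (hw i hi n)
      linarith
    rw [← Filter.map_add_atTop_eq_nat m]
    exact key
  have hC0 : 0 < C := hc0.trans_lt hcC
  have hpow : ∀ j : ℕ, ∀ᶠ n in Filter.atTop, y n ≤ C ^ j * (|M| + 1) := by
    intro j
    induction j with
    | zero =>
      filter_upwards [hM] with n hn
      have := le_abs_self M
      linarith
    | succ j ih =>
      have := step _ (by positivity) ih
      rwa [← mul_assoc, ← pow_succ'] at this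
  refine tendsto_order.2 ⟨fun a ha => .of_forall fun n => ha.trans_le (hy n), fun a ha => ?_⟩
  have h0 : Filter.Tendsto (fun j : ℕ => C ^ j * (|M| + 1)) Filter.atTop (nhds 0) := by
    simpa using (tendsto_pow_atTop_nhds_zero_of_lt_one hC0.le hC).mul_const (|M| + 1)
  obtain ⟨j, hj⟩ := (h0.eventually_lt_const ha).exists
  filter_upwards [hpow j] with n hn
  exact hn.trans_lt hj

/-- If consecutive terms have ratio tending to `ρ`, terms at distance `d` have ratio tending to
`ρ ^ d`. -/
theorem tendsto_ratio_pow {t : ℕ → ℝ} {ρ : ℝ} (ht : ∀ᶠ n in Filter.atTop, 0 < t n)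
    (hρ : Filter.Tendsto (fun n => t n / t (n + 1)) Filter.atTop (nhds ρ)) (a d : ℕ) :
    Filter.Tendsto (fun n => t (n + a) / t (n + (a + d))) Filter.atTop (nhds (ρ ^ d)) := by
  induction d with
  | zero =>
    refine tendsto_const_nhds.congr' ?_
    filter_upwards [(Filter.tendsto_add_atTop_nat a).eventually ht] with n hn
    rw [pow_zero, add_zero, div_self hn.ne']
  | succ d ih =>
    refine (ih.mul (hρ.comp (Filter.tendsto_add_atTop_nat (a + d)))).congr' ?_
    filter_upwards [(Filter.tendsto_add_atTop_nat (a + d)).eventually ht] with n hn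
    rw [Function.comp_apply, div_mul_div_cancel₀ hn.ne', ← add_assoc a, add_assoc n _ 1]

/-- A linear recurrence with small coefficients forces convergence of the ratio `f n / t n`. -/
theorem tendsto_ratio_of_recurrence {ι : Type*} (s : Finset ι) (f t g : ℕ → ℝ) (ρ M p L : ℝ)
    (e : ι → ℝ) (d : ι → ℕ) (m : ℕ) (ht : ∀ᶠ n in Filter.atTop, 0 < t n)
    (ht0 : ∀ n, 0 ≤ t n)
    (hρ : Filter.Tendsto (fun n => t n / t (n + 1)) Filter.atTop (nhds ρ))
    (hM : ∀ n, |f n| ≤ M * t n) (hd : ∀ i ∈ s, d i ≤ m)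
    (hrec : ∀ᶠ n in Filter.atTop, f (n + m) + ∑ i ∈ s, e i * f (n + d i) = g n)
    (hg : Filter.Tendsto (fun n => g n / t (n + m)) Filter.atTop (nhds L))
    (he : ∑ i ∈ s, |e i| * ρ ^ (m - d i) < 1)
    (hL : L = p * (1 + ∑ i ∈ s, e i * ρ ^ (m - d i))) :
    Filter.Tendsto (fun n => f n / t n) Filter.atTop (nhds p) := by
  have hq : ∀ i ∈ s, Filter.Tendsto (fun n => t (n + d i) / t (n + m)) Filter.atTop
      (nhds (ρ ^ (m - d i))) := by
    intro i hi
    have := tendsto_ratio_pow ht hρ (d i) (m - d i)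
    rwa [Nat.add_sub_cancel' (hd i hi)] at this
  have hr : Filter.Tendsto (fun n => |g n / t (n + m) - p -
      ∑ i ∈ s, e i * (t (n + d i) / t (n + m)) * p|) Filter.atTop (nhds 0) := by
    have h1 := (hg.sub_const p).sub (tendsto_finsetSum s fun i hi =>
      ((hq i hi).const_mul (e i)).mul_const p)
    -- `p` solves the limiting recurrence, so centring `f / t` at `p` leaves a forcing term that
    -- tends to zero.
    have h2 : L - p - ∑ i ∈ s, e i * ρ ^ (m - d i) * p = 0 := by
      rw [hL, ← Finset.sum_mul]
      ring
    rw [h2] at h1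
    simpa using h1.abs
  have hlim := tendsto_zero_of_contraction s (fun n => |f n / t n - p|) _
    (fun i n => |e i| * (t (n + d i) / t (n + m))) (fun i => |e i| * ρ ^ (m - d i)) d m
    (M + |p|) (fun n => abs_nonneg _) ?_ ?_ (fun i hi => (hq i hi).const_mul _) hr he ?_
  · rw [tendsto_iff_norm_sub_tendsto_zero]
    exact hlim
  · filter_upwards [ht] with n hn
    refine (abs_sub _ _).trans (add_le_add_left ?_ _)
    rw [abs_div, abs_of_pos hn, div_le_iff₀ hn]
    exact hM n
  · intro i _ n
    exact mul_nonneg (abs_nonneg _) (div_nonneg (ht0 _) (ht0 _))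
  · have hts : ∀ᶠ n in Filter.atTop, ∀ i ∈ s, 0 < t (n + d i) :=
      (Filter.eventually_all_finset s).2 fun i _ =>
        (Filter.tendsto_add_atTop_nat (d i)).eventually ht
    filter_upwards [hrec, (Filter.tendsto_add_atTop_nat m).eventually ht, hts] with n h1 h2 h3
    have h4 : f (n + m) / t (n + m) - p =
        -(∑ i ∈ s, e i * (t (n + d i) / t (n + m)) * (f (n + d i) / t (n + d i) - p)) +
        (g n / t (n + m) - p - ∑ i ∈ s, e i * (t (n + d i) / t (n + m)) * p) := by
      have h5 : ∑ i ∈ s, e i * (t (n + d i) / t (n + m)) * (f (n + d i) / t (n + d i) - p) =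
          (∑ i ∈ s, e i * f (n + d i)) / t (n + m) -
            ∑ i ∈ s, e i * (t (n + d i) / t (n + m)) * p := by
        rw [Finset.sum_div, ← Finset.sum_sub_distrib]
        refine Finset.sum_congr rfl fun i hi => ?_
        have := (h3 i hi).ne'
        field_simp
      rw [h5, ← h1, add_div]
      ring
    rw [h4]
    refine (abs_add_le _ _).trans (add_le_add_left ?_ _)
    rw [abs_neg]
    refine (Finset.abs_sum_le_sum_abs _ _).trans (Finset.sum_le_sum fun i hi => ?_)
    rw [abs_mul, abs_mul, abs_of_pos (div_pos (h3 i hi) h2)]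

/-! ### Explicit form of the generating functions -/

namespace PlaneTree
open PowerSeries

theorem rankGF_one : rankGF 1 = rankGF 0 - X := by
  rw [rankGF_zero]
  ring

theorem one_sub_rankGF_ne_zero (k : ℕ) : 1 - rankGF k ≠ 0 := by
  intro h
  have h0 : coeff 0 (rankGF k) = 0 := by
    rw [coeff_rankGF, ofSizeRankGE_eq_empty (Nat.zero_le k), Finset.card_empty, Nat.cast_zero]
  have := congrArg (coeff 0) h
  simp only [map_sub, h0, map_zero, coeff_zero_one] at this
  norm_num at this

theorem rankGF_two : (2 + X) * rankGF 2 = rankGF 0 - X - X ^ 2 := by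
  have h := rankGF_succ 1
  have h0 := rankGF_zero_sq
  rw [rankGF_one] at h
  have h1 : ((2 + X) * rankGF 2 - (rankGF 0 - X - X ^ 2)) * (1 - rankGF 1) = 0 := by
    rw [rankGF_one]
    linear_combination (2 + X) * h + h0
  exact sub_eq_zero.1 ((mul_eq_zero.1 h1).resolve_right (one_sub_rankGF_ne_zero 1))

/-- The map `z ↦ X z / (1 - z)` fixes `0` and `1 - X` and multiplies `z / (1 - X - z)` by `X`; its
`k`-th iterate at `T` is therefore explicit. -/
theorem rankGF_mul_denom (k : ℕ) :
    rankGF k * ((1 - X) - (1 - X ^ k) * rankGF 0) = X ^ k * (1 - X) * rankGF 0 := by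
  induction k with
  | zero => ring
  | succ k ih =>
    have h := rankGF_succ k
    have h1 : (rankGF (k + 1) * ((1 - X) - (1 - X ^ (k + 1)) * rankGF 0) -
        X ^ (k + 1) * (1 - X) * rankGF 0) = 0 := by
      linear_combination ((1 - X) - (1 - X ^ k) * rankGF 0) * h + (rankGF (k + 1) + X) * ih
    exact sub_eq_zero.1 h1

theorem rankGF_rational (j : ℕ) :
    rankGF (j + 3) * (1 + X ^ (j + 1) - 3 * X ^ (j + 2) + X ^ (2 * j + 5)) =
      X ^ (j + 1) * (1 - X) * ((1 - X) * rankGF 0 - X * (1 - X ^ (j + 3))) := by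
  have h := rankGF_mul_denom (j + 3)
  have h0 := rankGF_zero_sq
  have hX : (X : PowerSeries ℝ) ^ 2 ≠ 0 := pow_ne_zero _ X_ne_zero
  apply mul_left_cancel₀ hX
  -- The multiplier of `h` is the conjugate of the denominator; the product of the two is `X ^ 2`
  -- times the polynomial in the statement.
  linear_combination ((1 - X) - (1 - X ^ (j + 3)) * (1 - rankGF 0)) * h +
    (rankGF (j + 3) * (1 - X ^ (j + 3)) ^ 2 + X ^ (j + 3) * (1 - X) * (1 - X ^ (j + 3))) * h0

/-! ### Counts, geometric domination and recurrences -/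

/-- The number of trees with `n` vertices whose root has rank at least `k`, as a real number. -/
noncomputable def rankCount (k n : ℕ) : ℝ := ((ofSizeRankGE k n).card : ℝ)

theorem coeff_rankGF_eq_rankCount (k n : ℕ) : coeff n (rankGF k) = rankCount k n :=
  coeff_rankGF k n

theorem rankCount_nonneg (k n : ℕ) : 0 ≤ rankCount k n := Nat.cast_nonneg _

theorem rankCount_zero (n : ℕ) : rankCount 0 n = ((ofSize n).card : ℝ) := by
  rw [rankCount, ofSizeRankGE_zero]

theorem rankCount_le (k n : ℕ) : rankCount k n ≤ rankCount 0 n := by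
  rw [rankCount_zero, rankCount]
  exact_mod_cast Finset.card_filter_le _ _

theorem rankCount_eq_zero {k n : ℕ} (h : n ≤ k) : rankCount k n = 0 := by
  rw [rankCount, ofSizeRankGE_eq_empty h, Finset.card_empty, Nat.cast_zero]

theorem rankCount_zero_pos {n : ℕ} (hn : 1 ≤ n) : 0 < rankCount 0 n := by
  obtain ⟨n, rfl⟩ := Nat.exists_eq_add_of_le' hn
  rw [rankCount_zero]
  exact_mod_cast card_ofSize_pos n

/-- The constant is sharp at `n = 3`, where the counts are 2 and 5. -/
theorem five_mul_rankCount_zero_le {n : ℕ} (hn : 3 ≤ n) :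
    5 * rankCount 0 n ≤ 2 * rankCount 0 (n + 1) := by
  obtain ⟨n, rfl⟩ := Nat.exists_eq_add_of_le' hn
  have h := card_ofSize_ratio (n + 2)
  have hp := rankCount_zero_pos (n := n + 3 + 1) (by omega)
  rw [← rankCount_zero, ← rankCount_zero, div_eq_iff hp.ne'] at h
  have h2 : ((n + 2 : ℕ) + 2 : ℝ) / (4 * (n + 2 : ℕ) + 2) ≤ 2 / 5 := by
    rw [div_le_div_iff₀ (by positivity) (by norm_num)]
    push_cast
    have : (0 : ℝ) ≤ n := n.cast_nonneg
    linarith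
  have h3 := mul_le_mul_of_nonneg_right h2 hp.le
  have h4 : rankCount 0 (n + 3) = _ := h
  rw [h4]
  have h5 : n + 2 + 2 = n + 3 + 1 := by omega
  rw [h5]
  linarith

theorem tendsto_rankCount_zero_ratio :
    Filter.Tendsto (fun n => rankCount 0 n / rankCount 0 (n + 1)) Filter.atTop (nhds (1 / 4)) := by
  rw [← Filter.tendsto_add_atTop_iff_nat 1]
  have h : Filter.Tendsto (fun n : ℕ => (1 + 2 * ((n : ℝ))⁻¹) / (4 + 2 * ((n : ℝ))⁻¹))
      Filter.atTop (nhds ((1 + 2 * 0) / (4 + 2 * 0))) :=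
    ((tendsto_inv_atTop_nhds_zero_nat.const_mul 2).const_add 1).div
      ((tendsto_inv_atTop_nhds_zero_nat.const_mul 2).const_add 4) (by norm_num)
  norm_num at h
  norm_num
  refine h.congr' ?_
  filter_upwards [Filter.eventually_gt_atTop 0] with n hn
  rw [rankCount_zero, rankCount_zero, card_ofSize_ratio]
  have : (0 : ℝ) < n := by exact_mod_cast hn
  field_simp

theorem rankCount_succ (k n : ℕ) : rankCount (k + 1) (n + 1) = rankCount k n +
    ∑ p ∈ Finset.HasAntidiagonal.antidiagonal (n + 1), rankCount k p.1 * rankCount (k + 1) p.2 := by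
  have h := congrArg (coeff (n + 1)) (rankGF_succ k)
  rw [mul_add, map_add, coeff_succ_mul_X, coeff_mul] at h
  simpa only [coeff_rankGF_eq_rankCount] using h

theorem sum_rankCount_zero_mul (n : ℕ) :
    ∑ p ∈ Finset.HasAntidiagonal.antidiagonal (n + 2), rankCount 0 p.1 * rankCount 0 p.2 =
      rankCount 0 (n + 2) := by
  have h := congrArg (coeff (n + 2)) rankGF_zero_sq
  rw [coeff_mul, map_sub, coeff_X, if_neg (by omega), sub_zero] at h
  simpa only [coeff_rankGF_eq_rankCount] using h

theorem two_mul_rankCount_two_succ {n : ℕ} (hn : 2 ≤ n) :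
    2 * rankCount 2 (n + 1) + rankCount 2 n = rankCount 0 (n + 1) := by
  have h := congrArg (coeff (n + 1)) rankGF_two
  rw [add_mul, map_add, coeff_succ_X_mul, map_sub, map_sub, coeff_X, if_neg (by omega),
    coeff_X_pow, if_neg (by omega), two_mul, map_add] at h
  simp only [coeff_rankGF_eq_rankCount] at h
  linarith

/-- In the recursion the shifted term costs a factor `2/5` and the convolution a factor `1/2`; the
ratio `q = 4/5` is the solution of `2/5 + q/2 = q`. -/
theorem rankCount_bound (k n : ℕ) :
    rankCount (k + 2) n ≤ 1 / 2 * (4 / 5) ^ k * rankCount 0 n := by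
  induction k generalizing n with
  | zero =>
    rcases le_or_gt n 2 with hn | hn
    · rw [rankCount_eq_zero (by omega)]
      have := rankCount_nonneg 0 n
      positivity
    · obtain ⟨n, rfl⟩ := Nat.exists_eq_add_of_le' (by omega : 1 ≤ n)
      have h := two_mul_rankCount_two_succ (n := n) (by omega)
      have := rankCount_nonneg 2 n
      norm_num
      linarith
  | succ k ihk =>
    induction n using Nat.strong_induction_on with
    | _ n ih =>
      rcases le_or_gt n 3 with hn | hn
      · rw [rankCount_eq_zero (by omega)]
        have := rankCount_nonneg 0 n
        positivity
      · obtain ⟨n, rfl⟩ := Nat.exists_eq_add_of_le' (by omega : 2 ≤ n)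
        have hpow : (0 : ℝ) < (4 / 5) ^ k := by positivity
        have hpow1 : ((4 : ℝ) / 5) ^ k ≤ 1 := pow_le_one₀ (by norm_num) (by norm_num)
        have hrec := rankCount_succ (k + 2) (n + 1)
        have hsum : ∑ p ∈ Finset.HasAntidiagonal.antidiagonal (n + 2),
            rankCount (k + 2) p.1 * rankCount (k + 3) p.2 ≤
            ∑ p ∈ Finset.HasAntidiagonal.antidiagonal (n + 2),
              1 / 2 * (1 / 2 * (4 / 5) ^ (k + 1)) * (rankCount 0 p.1 * rankCount 0 p.2) := by
          refine Finset.sum_le_sum fun p hp => ?_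
          rw [Finset.HasAntidiagonal.mem_antidiagonal] at hp
          -- The term with `p.1 = 0` vanishes; in all others `p.2` is smaller than the current size,
          -- so the inner induction applies.
          rcases Nat.eq_zero_or_pos p.1 with h0 | h0
          · rw [h0, rankCount_eq_zero (Nat.zero_le _), rankCount_eq_zero (Nat.zero_le _)]
            simp
          · have h1 : rankCount (k + 2) p.1 ≤ 1 / 2 * rankCount 0 p.1 :=
              (ihk p.1).trans (mul_le_mul_of_nonneg_right (by linarith) (rankCount_nonneg _ _))
            have h2 := ih p.2 (by omega)
            have h3 := mul_le_mul h1 h2 (rankCount_nonneg _ _)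
              (mul_nonneg (by norm_num) (rankCount_nonneg _ _))
            refine h3.trans (le_of_eq ?_)
            ring
        rw [← Finset.mul_sum, sum_rankCount_zero_mul] at hsum
        have h1 := ihk (n + 1)
        have h2 := five_mul_rankCount_zero_le (n := n + 1) (by omega)
        have h3 := mul_le_mul_of_nonneg_left h2 hpow.le
        rw [show k + 1 + 2 = k + 2 + 1 from rfl, hrec]
        rw [pow_succ] at hsum ⊢
        linarith

theorem rankCount_add_three_rec (j n : ℕ) (hn : 2 ≤ n) :
    rankCount (j + 3) (n + (2 * j + 5)) + (rankCount (j + 3) (n + (j + 4)) -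
      3 * rankCount (j + 3) (n + (j + 3)) + rankCount (j + 3) (n + 0)) =
    rankCount 0 (n + (j + 4)) - 2 * rankCount 0 (n + (j + 3)) + rankCount 0 (n + (j + 2)) := by
  have h : rankGF (j + 3) + rankGF (j + 3) * X ^ (j + 1) + rankGF (j + 3) * X ^ (2 * j + 5) +
      2 * (rankGF 0 * X ^ (j + 2)) + X ^ (j + 2) + X ^ (2 * j + 6) =
      rankGF 0 * X ^ (j + 1) + rankGF 0 * X ^ (j + 3) + 3 * (rankGF (j + 3) * X ^ (j + 2)) +
      X ^ (j + 3) + X ^ (2 * j + 5) := by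
    linear_combination rankGF_rational j
  have h1 := congrArg (coeff (n + (2 * j + 5))) h
  have e : ∀ (f : PowerSeries ℝ) (a b : ℕ), n + (2 * j + 5) = a + b →
      coeff (n + (2 * j + 5)) (f * X ^ b) = coeff a f := by
    intro f a b hab
    rw [hab, coeff_mul_X_pow]
  have e2 : (2 : PowerSeries ℝ) = C 2 := (map_ofNat C 2).symm
  have e3 : (3 : PowerSeries ℝ) = C 3 := (map_ofNat C 3).symm
  rw [e2, e3] at h1
  simp only [map_add, coeff_C_mul] at h1
  rw [e _ (n + (j + 4)) (j + 1) (by omega), e _ (n + 0) (2 * j + 5) (by omega),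
    e _ (n + (j + 3)) (j + 2) (by omega), e _ (n + (j + 4)) (j + 1) (by omega),
    e _ (n + (j + 2)) (j + 3) (by omega), e _ (n + (j + 3)) (j + 2) (by omega),
    coeff_X_pow, coeff_X_pow, coeff_X_pow, coeff_X_pow, if_neg (by omega), if_neg (by omega),
    if_neg (by omega), if_neg (by omega)] at h1
  simp only [coeff_rankGF_eq_rankCount] at h1
  linarith

/-! ### Limits of the rank probabilities -/

/-- The limiting probability that the root has rank at least `k`. -/
noncomputable def rankLimit (k : ℕ) : ℝ := 9 / ((4 : ℝ) ^ (1 - (k : ℤ)) + 4 + (4 : ℝ) ^ (k : ℤ))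

theorem rankLimit_eq (k : ℕ) :
    rankLimit k = 9 * (1 / 4) ^ k / (4 * ((1 / 4) ^ k) ^ 2 + 4 * (1 / 4) ^ k + 1) := by
  rw [rankLimit, zpow_sub₀ (by norm_num), zpow_one, zpow_natCast, one_div, inv_pow]
  have : (0 : ℝ) < 4 ^ k := by positivity
  field_simp

theorem tendsto_rankCount_ratio (k : ℕ) (hk : 1 ≤ k) :
    Filter.Tendsto (fun n => rankCount k n / rankCount 0 n) Filter.atTop
      (nhds (rankLimit k)) := by
  have ht : ∀ᶠ n in Filter.atTop, 0 < rankCount 0 n :=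
    (Filter.eventually_ge_atTop 1).mono fun n hn => rankCount_zero_pos hn
  have hρ := tendsto_rankCount_zero_ratio
  have hM : ∀ k n, |rankCount k n| ≤ 1 * rankCount 0 n := fun k n => by
    rw [abs_of_nonneg (rankCount_nonneg k n), one_mul]
    exact rankCount_le k n
  -- Only for `k ≥ 3` does the denominator divided by `X ^ 2` have constant term 1, as the general
  -- recurrence needs.
  obtain rfl | rfl | hk3 : k = 1 ∨ k = 2 ∨ 3 ≤ k := by omega
  · have h1 : rankLimit 1 = 1 := by
      rw [rankLimit_eq]
      norm_num
    rw [h1]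
    refine tendsto_const_nhds.congr' ?_
    filter_upwards [Filter.eventually_ge_atTop 2] with n hn
    have h := congrArg (coeff n) rankGF_one
    rw [map_sub, coeff_X, if_neg (by omega), sub_zero] at h
    simp only [coeff_rankGF_eq_rankCount] at h
    rw [h, div_self (rankCount_zero_pos (by omega)).ne']
  · refine tendsto_ratio_of_recurrence {()} (rankCount 2) (rankCount 0)
      (fun n => 1 / 2 * rankCount 0 (n + 1)) (1 / 4) 1 _ (1 / 2) (fun _ => 1 / 2) (fun _ => 0) 1
      ht (rankCount_nonneg 0) hρ (hM 2) (by simp) ?_ ?_ ?_ ?_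
    · filter_upwards [Filter.eventually_ge_atTop 2] with n hn
      have := two_mul_rankCount_two_succ hn
      rw [Finset.sum_singleton, add_zero]
      linarith
    · refine tendsto_const_nhds.congr' ?_
      filter_upwards with n
      rw [mul_div_assoc, div_self (rankCount_zero_pos (by omega)).ne', mul_one]
    · norm_num
    · rw [rankLimit_eq]
      norm_num
  · obtain ⟨j, rfl⟩ := Nat.exists_eq_add_of_le' hk3
    have hx0 : (0 : ℝ) < (1 / 4) ^ j := by positivity
    have hx1 : ((1 : ℝ) / 4) ^ j ≤ 1 := pow_le_one₀ (by norm_num) (by norm_num)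
    have hL : ∀ a, a ≤ 2 * j + 5 → Filter.Tendsto
        (fun n => rankCount 0 (n + a) / rankCount 0 (n + (2 * j + 5))) Filter.atTop
        (nhds ((1 / 4) ^ (2 * j + 5 - a))) := by
      intro a ha
      have := tendsto_ratio_pow ht hρ a (2 * j + 5 - a)
      rwa [Nat.add_sub_cancel' ha] at this
    have s1 : 2 * j + 5 - (j + 4) = j + 1 := by omega
    have s2 : 2 * j + 5 - (j + 3) = j + 2 := by omega
    have s3 : 2 * j + 5 - (j + 2) = j + 3 := by omega
    refine tendsto_ratio_of_recurrence Finset.univ (rankCount (j + 3)) (rankCount 0)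
      (fun n => rankCount 0 (n + (j + 4)) - 2 * rankCount 0 (n + (j + 3)) +
        rankCount 0 (n + (j + 2))) (1 / 4) 1 _
      ((1 / 4) ^ (j + 1) - 2 * (1 / 4) ^ (j + 2) + (1 / 4) ^ (j + 3))
      (![1, -3, 1] : Fin 3 → ℝ) ![j + 4, j + 3, 0] (2 * j + 5)
      ht (rankCount_nonneg 0) hρ (hM _) ?_ ?_ ?_ ?_ ?_
    · intro i _
      fin_cases i <;> simp <;> omega
    · filter_upwards [Filter.eventually_ge_atTop 2] with n hn
      rw [← rankCount_add_three_rec j n hn]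
      simp [Fin.sum_univ_three]
      ring
    · have := ((hL (j + 4) (by omega)).sub ((hL (j + 3) (by omega)).const_mul 2)).add
        (hL (j + 2) (by omega))
      rw [s1, s2, s3] at this
      refine this.congr fun n => ?_
      ring
    -- The weight is largest at `j = 0`, where it is `1/4 + 3/16 + 1/1024 < 1`.
    · have h5 : ((1 : ℝ) / 4) ^ (2 * j + 5) ≤ (1 / 4) ^ 5 :=
        pow_le_pow_of_le_one (by norm_num) (by norm_num) (by omega)
      simp only [Fin.sum_univ_three, Matrix.cons_val, s1, s2, Nat.sub_zero]
      rw [pow_add _ j, pow_add _ j]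
      norm_num at h5 hx1 ⊢
      linarith
    · simp only [Fin.sum_univ_three, Matrix.cons_val, s1, s2, Nat.sub_zero]
      rw [rankLimit_eq, show 2 * j + 5 = j + j + 5 by ring]
      simp only [pow_add]
      set x : ℝ := (1 / 4) ^ j
      have : 4 * (x * (1 / 4) ^ 3) ^ 2 + 4 * (x * (1 / 4) ^ 3) + 1 ≠ 0 := by positivity
      field_simp
      ring

end PlaneTree

/-! ### The expected rank and its numerical value -/

namespace PlaneTree

theorem natCast_eq_tsum_indicator (r : ℕ) :
    (r : ℝ) = ∑' k : ℕ, if k + 1 ≤ r then (1 : ℝ) else 0 := by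
  rw [tsum_eq_sum (s := Finset.range r)]
  · rw [Finset.sum_congr rfl fun k hk => if_pos (Nat.succ_le_of_lt (Finset.mem_range.1 hk))]
    simp
  · intro k hk
    rw [Finset.mem_range] at hk
    exact if_neg hk

/-- Tail-sum formula for the mean; at `n = 0` both sides are zero because division by zero gives
zero. -/
theorem expectedRootRank_eq_tsum (n : ℕ) :
    expectedRootRank n = ∑' k : ℕ, rankCount (k + 1) n / rankCount 0 n := by
  have hs : ∀ t ∈ ofSize n, Summable fun k : ℕ => if k + 1 ≤ rootRank t then (1 : ℝ) else 0 := by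
    intro t _
    refine summable_of_ne_finset_zero (s := Finset.range (rootRank t)) fun k hk => ?_
    rw [Finset.mem_range] at hk
    exact if_neg hk
  rw [expectedRootRank, tsum_div_const, rankCount_zero]
  congr 1
  rw [Finset.sum_congr rfl fun t _ => natCast_eq_tsum_indicator (rootRank t),
    ← Summable.tsum_finsetSum hs]
  refine tsum_congr fun k => ?_
  rw [rankCount, ofSizeRankGE, Finset.sum_boole]

theorem rankCount_ratio_le (k n : ℕ) :
    rankCount (k + 1) n / rankCount 0 n ≤ (4 / 5) ^ k := by
  refine div_le_of_le_mul₀ (rankCount_nonneg 0 n) (by positivity) ?_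
  cases k with
  | zero => simpa using rankCount_le 1 n
  | succ k =>
    refine (rankCount_bound k n).trans (mul_le_mul_of_nonneg_right ?_ (rankCount_nonneg 0 n))
    have : (0 : ℝ) < (4 / 5) ^ k := by positivity
    rw [pow_succ]
    linarith

theorem tendsto_expectedRootRank :
    Filter.Tendsto expectedRootRank Filter.atTop (nhds (∑' k : ℕ, rankLimit (k + 1))) := by
  rw [funext expectedRootRank_eq_tsum]
  refine tendsto_tsum_of_dominated_convergence (bound := fun k : ℕ => (4 / 5 : ℝ) ^ k)
    (summable_geometric_of_lt_one (by norm_num) (by norm_num))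
    (fun k => tendsto_rankCount_ratio (k + 1) (by omega)) (.of_forall fun n k => ?_)
  rw [Real.norm_of_nonneg (div_nonneg (rankCount_nonneg _ _) (rankCount_nonneg _ _))]
  exact rankCount_ratio_le k n

theorem rankLimit_nonneg (k : ℕ) : 0 ≤ rankLimit k := by
  rw [rankLimit]
  positivity

theorem rankLimit_le (k : ℕ) : rankLimit k ≤ 9 * (1 / 4) ^ k := by
  rw [rankLimit_eq]
  have : (0 : ℝ) < (1 / 4) ^ k := by positivity
  exact div_le_self (by positivity) (by nlinarith)

theorem hasSum_geometric_quarter (m : ℕ) :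
    HasSum (fun k : ℕ => 9 * ((1 : ℝ) / 4) ^ (k + m)) (12 * (1 / 4) ^ m) := by
  have h := (hasSum_geometric_of_lt_one (r := (1 : ℝ) / 4) (by norm_num) (by norm_num)).mul_left
    (9 * (1 / 4) ^ m)
  have e1 : 9 * ((1 : ℝ) / 4) ^ m * (1 - 1 / 4)⁻¹ = 12 * (1 / 4) ^ m := by ring
  rw [e1] at h
  refine (funext fun k => ?_ : (fun k : ℕ => 9 * ((1 : ℝ) / 4) ^ (k + m)) = _) ▸ h
  ring

theorem summable_rankLimit : Summable fun k : ℕ => rankLimit (k + 1) :=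
  .of_nonneg_of_le (fun _ => rankLimit_nonneg _) (fun k => rankLimit_le (k + 1))
    (hasSum_geometric_quarter 1).summable

theorem abs_tsum_rankLimit_sub_lt :
    |∑' k : ℕ, rankLimit (k + 1) - 1.62297| < (5 : ℝ) / 10 ^ 6 := by
  -- After twelve exact terms the tail is at most `12 / 4 ^ 13 < 2 / 10 ^ 7`.
  have h := summable_rankLimit.sum_add_tsum_nat_add 12
  have h0 : 0 ≤ ∑' k : ℕ, rankLimit (k + 12 + 1) := tsum_nonneg fun _ => rankLimit_nonneg _
  have h1 : ∑' k : ℕ, rankLimit (k + 12 + 1) ≤ 12 * (1 / 4) ^ 13 :=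
    hasSum_le (fun k => rankLimit_le (k + 13))
      ((summable_nat_add_iff 12).2 summable_rankLimit).hasSum (hasSum_geometric_quarter 13)
  rw [← h]
  simp only [Finset.sum_range_succ, Finset.sum_range_zero, rankLimit_eq] at h0 h1 ⊢
  rw [abs_lt]
  constructor
  · norm_num at h0 ⊢
    linarith
  · norm_num at h1 ⊢
    linarith

end PlaneTree

theorem theorem5 :
    Summable (fun k : ℕ+ => 9 / ((4 : ℝ) ^ (1 - (k : ℤ)) + 4 + (4 : ℝ) ^ (k : ℤ))) ∧
    Filter.Tendsto PlaneTree.expectedRootRank Filter.atTop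
      (nhds (∑' k : ℕ+, 9 / ((4 : ℝ) ^ (1 - (k : ℤ)) + 4 + (4 : ℝ) ^ (k : ℤ)))) ∧
    |(∑' k : ℕ+, 9 / ((4 : ℝ) ^ (1 - (k : ℤ)) + 4 + (4 : ℝ) ^ (k : ℤ))) - 1.62297| <
      (5 : ℝ) / 10 ^ 6 := by
  have h : (fun k : ℕ+ => 9 / ((4 : ℝ) ^ (1 - (k : ℤ)) + 4 + (4 : ℝ) ^ (k : ℤ))) =
      fun k : ℕ+ => PlaneTree.rankLimit k := by
    funext k
    simp [PlaneTree.rankLimit]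
  rw [h, tsum_pnat_eq_tsum_succ (f := PlaneTree.rankLimit)]
  exact ⟨summable_pnat_iff_summable_succ.2 PlaneTree.summable_rankLimit,
    PlaneTree.tendsto_expectedRootRank, PlaneTree.abs_tsum_rankLimit_sub_lt⟩
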